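/- Let $n\ge 2$, $a<b$, let $\varrho\in C^\infty([a,b];\mathbb{R}_{>0})$, and let $\gamma\in C^\infty([a,b];\mathbb{R}^n)$ be a curve parametrized by arc-length ($|\gamma'|\equiv 1$) which is elastic with bending stiffness $\varrho$: for every smooth variation $(t,x)\mapsto\gamma_t(x)$, $t\in[-\epsilon,\epsilon]$, $\epsilon>0$, of $\gamma$ (so $\gamma_0=\gamma$) such that $\gamma_t=\gamma$ near both end points of $[a,b]$ (on a neighbourhood independent of $t$) and $|\gamma_t'|=|\gamma'|$ for all $t$, one has $\tfrac{d}{dt}\big|_{t=0}\mathcal{B}_\varrho(\gamma_t)=0$. Here $\mathcal{B}_\varrho(\gamma)=\tfrac12\int_a^b\varrho\,\langle\tfrac{dT}{ds},\tfrac{dT}{ds}\rangle\,ds$ is the bending energy, with $\tfrac{d}{ds}=\tfrac{1}{|\gamma'|}\tfrac{d}{dx}$, $ds=|\gamma'|\,dx$ and $T=\tfrac{d\gamma}{ds}$. Call $\Lambda\in C^\infty([a,b];\mathbb{R})$ a multiplier of $\gamma$ if on $[a,b]$ $$\varrho T'''+3\varrho\langle T',T''\rangle T+\tfrac32\varrho\langle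 T',T'\rangle T'+\varrho''T'+2\varrho'T''+\tfrac32\varrho'\langle T',T'\rangle T-\Lambda'T-\Lambda T'=0 .$$ Call a function $\Lambda\colon[a,b]\to\mathbb{R}$ and a vector $\mathbf a\in\mathbb{R}^n$ a pendulum pair of $\gamma$ if on $[a,b]$ $$\varrho T''+\varrho'T'-\varrho\langle T'',T\rangle T=\mathbf a-\langle\mathbf a,T\rangle T\quad\text{and}\quad \Lambda=\tfrac12\varrho\langle T',T'\rangle-\langle\mathbf a,T\rangle .$$ Then $\gamma$ has a multiplier; for every multiplier $\Lambda$ there is a vector $\mathbf a\in\mathbb{R}^n$ such that $(\Lambda,\mathbf a)$ is a pendulum pair; and for every pendulum pair $(\Lambda,\mathbf a)$ $$\mathcal{B}_\varrho(\gamma)=\int_a^b\Lambda(x)\,dx+\langle\mathbf a,\gamma(b)-\gamma(a)\rangle .$$ -/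

import Mathlib

open scoped ContDiff

noncomputable section

/-! Curves in `ℝⁿ` are functions `ℝ → EuclideanSpace ℝ (Fin n)` of which only the values on `[a, b]`
matter: smoothness is `ContDiffOn ℝ ∞` on `Set.Icc a b`, and all derivatives are one-sided at the
end points, i.e. taken within `Set.Icc a b`. -/

namespace ElasticCurve

/-- The derivative `g'` of a function on `[a, b]` with respect to the parameter. -/
def paramDeriv (a b : ℝ) {F : Type*} [NormedAddCommGroup F] [NormedSpace ℝ F]
    (g : ℝ → F) : ℝ → F :=
  fun x => derivWithin g (Set.Icc a b) x

/-- The derivative `dg/ds = g' / |γ'|` of `g` with respect to the arc-length of `γ`. -/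
def arcDeriv (a b : ℝ) {n : ℕ} (γ : ℝ → EuclideanSpace ℝ (Fin n))
    {F : Type*} [NormedAddCommGroup F] [NormedSpace ℝ F] (g : ℝ → F) : ℝ → F :=
  fun x => ‖paramDeriv a b γ x‖⁻¹ • paramDeriv a b g x

/-- The unit tangent field `T = dγ/ds`. -/
def unitTangent (a b : ℝ) {n : ℕ} (γ : ℝ → EuclideanSpace ℝ (Fin n)) :
    ℝ → EuclideanSpace ℝ (Fin n) :=
  arcDeriv a b γ γ

/-- The bending energy `½ ∫ ϱ ⟨dT/ds, dT/ds⟩ ds` with bending stiffness `ϱ`, where `ds = |γ'| dx`. -/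
def bendingEnergy (a b : ℝ) {n : ℕ} (ϱ : ℝ → ℝ) (γ : ℝ → EuclideanSpace ℝ (Fin n)) : ℝ :=
  (1 / 2) * ∫ x in a..b,
    ϱ x * inner ℝ (arcDeriv a b γ (unitTangent a b γ) x) (arcDeriv a b γ (unitTangent a b γ) x)
      * ‖paramDeriv a b γ x‖

/-- `γ` is a smooth curve on `[a, b]` parametrized by arc-length. -/
structure IsArcLengthCurve (a b : ℝ) {n : ℕ} (γ : ℝ → EuclideanSpace ℝ (Fin n)) : Prop where
  smooth : ContDiffOn ℝ ∞ γ (Set.Icc a b)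
  unit_speed : ∀ x ∈ Set.Icc a b, ‖paramDeriv a b γ x‖ = 1

/-- `ϱ` is a smooth positive function on `[a, b]`. -/
structure IsStiffness (a b : ℝ) (ϱ : ℝ → ℝ) : Prop where
  smooth : ContDiffOn ℝ ∞ ϱ (Set.Icc a b)
  pos : ∀ x ∈ Set.Icc a b, 0 < ϱ x

/-- `t ↦ Γ t`, `t ∈ [-ε, ε]`, is a smooth variation of `γ` with compact support in the interior of
`[a, b]` that preserves the arc-length `|γ'|` pointwise. -/
structure IsAdmissibleVariation (a b : ℝ) {n : ℕ} (γ : ℝ → EuclideanSpace ℝ (Fin n))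
    (ε : ℝ) (Γ : ℝ → ℝ → EuclideanSpace ℝ (Fin n)) : Prop where
  eps_pos : 0 < ε
  smooth : ContDiffOn ℝ ∞ (fun p : ℝ × ℝ => Γ p.1 p.2) (Set.Icc (-ε) ε ×ˢ Set.Icc a b)
  at_zero : ∀ x ∈ Set.Icc a b, Γ 0 x = γ x
  compact_support : ∃ δ > 0, ∀ t ∈ Set.Icc (-ε) ε, ∀ x ∈ Set.Icc a b,
    (x ≤ a + δ ∨ b - δ ≤ x) → Γ t x = γ x
  arcLength_preserving : ∀ t ∈ Set.Icc (-ε) ε, ∀ x ∈ Set.Icc a b,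
    ‖paramDeriv a b (Γ t) x‖ = ‖paramDeriv a b γ x‖

/-- `γ` is elastic with bending stiffness `ϱ`: an arc-length parametrized curve that is a critical
point of the bending energy under all smooth variations with compact support in the interior that
preserve the arc-length. -/
structure IsElastic (a b : ℝ) {n : ℕ} (ϱ : ℝ → ℝ) (γ : ℝ → EuclideanSpace ℝ (Fin n)) :
    Prop where
  arcLength : IsArcLengthCurve a b γ
  critical : ∀ (ε : ℝ) (Γ : ℝ → ℝ → EuclideanSpace ℝ (Fin n)),
    IsAdmissibleVariation a b γ ε Γ → HasDerivAt (fun t => bendingEnergy a b ϱ (Γ t)) 0 0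

/-- `Λ` is a (smooth) pointwise Lagrange multiplier of the arc-length constraint for the arc-length
parametrized curve `γ`: the Euler-Lagrange equation
`ϱ T''' + 3 ϱ ⟨T', T''⟩ T + 3/2 ϱ ⟨T', T'⟩ T' + ϱ'' T' + 2 ϱ' T'' + 3/2 ϱ' ⟨T', T'⟩ T - Λ' T - Λ T' = 0`
holds on `[a, b]`. -/
def IsMultiplier (a b : ℝ) {n : ℕ} (ϱ : ℝ → ℝ) (γ : ℝ → EuclideanSpace ℝ (Fin n))
    (Λ : ℝ → ℝ) : Prop :=
  let T := unitTangent a b γ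
  let T₁ := paramDeriv a b T
  let T₂ := paramDeriv a b T₁
  let T₃ := paramDeriv a b T₂
  let ϱ₁ := paramDeriv a b ϱ
  let ϱ₂ := paramDeriv a b ϱ₁
  ContDiffOn ℝ ∞ Λ (Set.Icc a b) ∧
  ∀ x ∈ Set.Icc a b,
    ϱ x • T₃ x + (3 * ϱ x * inner ℝ (T₁ x) (T₂ x)) • T x
      + (3 / 2 * ϱ x * inner ℝ (T₁ x) (T₁ x)) • T₁ x
      + ϱ₂ x • T₁ x + (2 * ϱ₁ x) • T₂ x
      + (3 / 2 * ϱ₁ x * inner ℝ (T₁ x) (T₁ x)) • T x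
      - paramDeriv a b Λ x • T x - Λ x • T₁ x = 0

/-- The vector `A` and the function `Λ` are as in the pendulum characterization of `γ`:
`ϱ T'' + ϱ' T' - ϱ ⟨T'', T⟩ T = A - ⟨A, T⟩ T` and `Λ = ½ ϱ ⟨T', T'⟩ - ⟨A, T⟩` on `[a, b]`. -/
def IsPendulumPair (a b : ℝ) {n : ℕ} (ϱ : ℝ → ℝ) (γ : ℝ → EuclideanSpace ℝ (Fin n))
    (Λ : ℝ → ℝ) (A : EuclideanSpace ℝ (Fin n)) : Prop :=
  let T := unitTangent a b γ
  let T₁ := paramDeriv a b T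
  let T₂ := paramDeriv a b T₁
  (∀ x ∈ Set.Icc a b,
    ϱ x • T₂ x + paramDeriv a b ϱ x • T₁ x - (ϱ x * inner ℝ (T₂ x) (T x)) • T x
      = A - inner ℝ A (T x) • T x) ∧
  ∀ x ∈ Set.Icc a b, Λ x = 1 / 2 * ϱ x * inner ℝ (T₁ x) (T₁ x) - inner ℝ A (T x)

end ElasticCurve

end

/-! A unit-speed variation fixed near both ends amounts to a compactly supported variation of the
tangent field `T = γ'` through unit fields with unchanged integral. Integration by parts shows that
a direction `τ ⊥ T` changes the energy at the rate `-∫ ⟨W, τ⟩`, where `W = (ϱ T')'`. If this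
vanishes for every normal `τ` with `∫ τ = 0`, linear algebra gives a vector `A` with `∫ ⟨W - A, τ⟩ =
0` for all normal `τ`, so `W - A` is parallel to `T`. This is the pendulum equation
(`IsElastic.exists_isPendulumPair`).

The delicate point is that a direction with `∫ τ = 0` must be tangent to a true variation with exact
closing condition. If integrals of normal fields fill `ℝⁿ`, the implicit function theorem corrects
the second-order error (`exists_implicit_curve`, `IsElastic.integral_inner_force_eq_zero`).
Otherwise `γ` is a straight segment, where `Λ = 0`, `A = 0` works
(`paramDeriv_eq_zero_or_integral_surjective`).

The rest is a conservation law. The Euler-Lagrange expression is the derivative of `F = ϱ T'' + ϱ'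
T' + (3/2 ϱ |T'|² - Λ) T` (`isMultiplier_iff`), and a pendulum pair says `F = A`
(`isPendulumPair_iff`). The energy formula is the integral of `Λ + ⟨A, T⟩ = ½ ϱ |T'|²`. -/

namespace ElasticCurve

open Set MeasureTheory Filter Topology

/-! ### Smooth dependence of integrals, implicit functions and cutoffs. -/

section Calculus

variable {F : Type*} [NormedAddCommGroup F] [NormedSpace ℝ F]

/-- Extends data that are smooth only on `[a, b]` to globally smooth functions, after a cutoff. -/
theorem contDiff_smul_of_tsupport_subset {a b : ℝ} {φ : ℝ → ℝ} {W : ℝ → F}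
    (hφ : ContDiff ℝ ∞ φ) (hs : tsupport φ ⊆ Ioo a b) (hW : ContDiffOn ℝ ∞ W (Icc a b)) :
    ContDiff ℝ ∞ (fun x => φ x • W x) := by
  refine contDiff_iff_contDiffAt.2 fun x => ?_
  by_cases hx : x ∈ tsupport φ
  swap
  · have h0 : (fun x => φ x • W x) =ᶠ[𝓝 x] fun _ => 0 := by
      filter_upwards [notMem_tsupport_iff_eventuallyEq.1 hx] with y hy
      simp [hy]
    exact contDiffAt_const.congr_of_eventuallyEq h0
  have hx' : x ∈ Ioo a b := hs hx
  exact hφ.contDiffAt.smul (hW.contDiffAt (Icc_mem_nhds hx'.1 hx'.2))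

theorem eqOn_zero_of_integral_mul_eq_zero {a b : ℝ} (hab : a < b) {f : ℝ → ℝ}
    (hf : ContinuousOn f (Icc a b))
    (h : ∀ φ : ℝ → ℝ, ContDiff ℝ ∞ φ → HasCompactSupport φ → tsupport φ ⊆ Ioo a b →
      ∫ x in a..b, φ x * f x = 0) : ∀ x ∈ Icc a b, f x = 0 := by
  have h1 : ∀ᵐ x, x ∈ Ioo a b → f x = 0 := by
    refine isOpen_Ioo.ae_eq_zero_of_integral_contDiff_smul_eq_zero
      ((hf.mono Ioo_subset_Icc_self).locallyIntegrableOn measurableSet_Ioo) ?_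
    intro φ hφ hc hs
    rw [← h φ hφ hc hs, intervalIntegral.integral_eq_integral_of_support_subset]
    · rfl
    · intro x hx
      exact Ioo_subset_Ioc_self (hs (subset_tsupport _ (left_ne_zero_of_mul hx)))
  have h2 : EqOn f 0 (Ioo a b) :=
    Measure.eqOn_open_of_ae_eq ((ae_restrict_iff' measurableSet_Ioo).2 h1) isOpen_Ioo
      (hf.mono Ioo_subset_Icc_self) continuousOn_const
  have h3 : EqOn f 0 (Icc a b) :=
    h2.of_subset_closure hf continuousOn_const Ioo_subset_Icc_self
      (by rw [closure_Ioo hab.ne])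
  exact h3

/-- Since `g p` vanishes left of `a`, the primitive is its convolution with the Heaviside function,
and convolution with a locally integrable function preserves smoothness jointly in the parameter. -/
theorem contDiff_primitive_of_compact_support [CompleteSpace F]
    {P : Type*} [NormedAddCommGroup P] [NormedSpace ℝ P]
    {a b : ℝ} {K : Set ℝ} (hK : IsCompact K) (hKs : K ⊆ Ioo a b) {g : P → ℝ → F}
    (hg : ContDiff ℝ ∞ (fun q : P × ℝ => g q.1 q.2)) (hgs : ∀ p, ∀ x ∉ K, g p x = 0) :
    ContDiff ℝ ∞ (fun q : P × ℝ => ∫ y in a..q.2, g q.1 y) := by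
  have hf : LocallyIntegrable (indicator (Ici (0 : ℝ)) (fun _ => (1 : ℝ))) :=
    (locallyIntegrable_const 1).indicator measurableSet_Ici
  have key := contDiffOn_convolution_right_with_param (n := ⊤) (μ := volume)
    (ContinuousLinearMap.lsmul ℝ ℝ : ℝ →L[ℝ] F →L[ℝ] F) isOpen_univ hK
    (fun p x _ hx => hgs p x hx) hf (g := g) (s := univ) (by
      rw [univ_prod_univ]; exact hg.contDiffOn)
  rw [univ_prod_univ, contDiffOn_univ] at key
  convert key using 1
  ext ⟨p, x⟩
  have hgc : Continuous (g p) := by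
    have := hg.continuous
    fun_prop
  have hcs : HasCompactSupport (g p) := HasCompactSupport.intro hK (hgs p)
  have hint : Integrable (g p) := hgc.integrable_of_hasCompactSupport hcs
  have h0 : ∫ y in Iic a, g p y = 0 := by
    refine setIntegral_eq_zero_of_forall_eq_zero fun y hy => hgs p y fun hyK => ?_
    exact absurd (hKs hyK).1 (not_lt.2 hy)
  refine Eq.symm ?_
  simp only [convolution_eq_swap]
  simp only [ContinuousLinearMap.lsmul_apply]
  have h1 : (fun t => indicator (Ici (0 : ℝ)) (fun _ => (1 : ℝ)) (x - t) • g p t)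
      = indicator (Iic x) (g p) := by
    ext t
    by_cases ht : t ≤ x
    · simp [ht]
    · simp [ht]
  rw [h1, integral_indicator measurableSet_Iic,
    ← intervalIntegral.integral_Iic_sub_Iic hint.integrableOn hint.integrableOn, h0, sub_zero]

theorem contDiff_integral_of_compact_support [CompleteSpace F]
    {P : Type*} [NormedAddCommGroup P] [NormedSpace ℝ P]
    {a b : ℝ} {K : Set ℝ} (hK : IsCompact K) (hKs : K ⊆ Ioo a b) {g : P → ℝ → F}
    (hg : ContDiff ℝ ∞ (fun q : P × ℝ => g q.1 q.2)) (hgs : ∀ p, ∀ x ∉ K, g p x = 0) :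
    ContDiff ℝ ∞ (fun p : P => ∫ y in a..b, g p y) :=
  (contDiff_primitive_of_compact_support hK hKs hg hgs).comp
    (contDiff_id.prodMk contDiff_const : ContDiff ℝ ∞ (fun p : P => (p, b)))

theorem hasDerivAt_integral_of_contDiff {a b : ℝ} {h : ℝ → ℝ → F} {h' : ℝ → F}
    (hh : ContDiff ℝ ∞ (fun q : ℝ × ℝ => h q.1 q.2))
    (hd : ∀ x, HasDerivAt (fun s => h s x) (h' x) 0) :
    HasDerivAt (fun s => ∫ x in a..b, h s x) (∫ x in a..b, h' x) 0 := by
  set D : ℝ → ℝ → F := fun s x => fderiv ℝ (fun q : ℝ × ℝ => h q.1 q.2) (s, x) (1, 0)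
  have hD : ∀ s x, HasDerivAt (fun s => h s x) (D s x) s := by
    intro s x
    have h1 := (hh.differentiable (by simp) (s, x)).hasFDerivAt
    have h2 : HasDerivAt (fun s : ℝ => (s, x)) ((1 : ℝ), (0 : ℝ)) s :=
      (hasDerivAt_id s).prodMk (hasDerivAt_const s x)
    exact h1.comp_hasDerivAt s h2
  have hDc : Continuous (fun q : ℝ × ℝ => D q.1 q.2) :=
    (hh.continuous_fderiv (by simp)).clm_apply continuous_const
  have hc := hh.continuous
  obtain ⟨C, hC⟩ := ((isCompact_Icc (a := (-1 : ℝ)) (b := 1)).prod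
    (isCompact_uIcc (a := a) (b := b))).exists_bound_of_continuousOn hDc.continuousOn
  have h0 : h' = D 0 := funext fun x => (hd x).unique (hD 0 x)
  rw [h0]
  refine (intervalIntegral.hasDerivAt_integral_of_dominated_loc_of_deriv_le
    (F := h) (F' := D) (bound := fun _ => C) (s := Icc (-1) 1)
    (Icc_mem_nhds (by norm_num) (by norm_num)) ?_ ?_ ?_ ?_ ?_ ?_).2
  · refine Eventually.of_forall fun s => Continuous.aestronglyMeasurable ?_
    fun_prop
  · refine Continuous.intervalIntegrable ?_ _ _
    fun_prop
  · refine Continuous.aestronglyMeasurable ?_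
    fun_prop
  · refine Eventually.of_forall fun x hx s hs => hC (s, x) ⟨hs, uIoc_subset_uIcc hx⟩
  · exact intervalIntegrable_const
  · exact Eventually.of_forall fun x _ s _ => hD s x

/-- The map `(t, e) ↦ (t, Φ (t, e))` has the identity as derivative at `0`; its local inverse,
restricted to the `t`-axis, yields `u`, tangent to that axis. -/
theorem exists_implicit_curve {E : Type*} [NormedAddCommGroup E] [NormedSpace ℝ E]
    [CompleteSpace E] {Φ : ℝ × E → E} (hΦ : ContDiff ℝ ∞ Φ) (h0 : Φ 0 = 0)
    (hd : fderiv ℝ Φ 0 = ContinuousLinearMap.snd ℝ ℝ E) :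
    ∃ ε > 0, ∃ u : ℝ → E, ContDiffOn ℝ ∞ u (Ioo (-ε) ε) ∧ u 0 = 0 ∧ HasDerivAt u 0 0 ∧
      ∀ t ∈ Ioo (-ε) ε, Φ (t, u t) = 0 := by
  set H : ℝ × E → ℝ × E := fun q => (q.1, Φ q)
  have hH : ContDiff ℝ ∞ H := contDiff_fst.prodMk hΦ
  have hΦd : HasFDerivAt Φ (ContinuousLinearMap.snd ℝ ℝ E) 0 :=
    hd ▸ (hΦ.differentiable (by simp) 0).hasFDerivAt
  have hHd : HasFDerivAt H ((ContinuousLinearEquiv.refl ℝ (ℝ × E) : (ℝ × E) ≃L[ℝ] (ℝ × E)) :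
      ℝ × E →L[ℝ] ℝ × E) 0 :=
    hasFDerivAt_fst.prodMk hΦd
  have hne : (∞ : WithTop ℕ∞) ≠ 0 := by simp
  set R := hH.contDiffAt.toOpenPartialHomeomorph H hHd hne
  have hR0 : (0 : ℝ × E) ∈ R.source :=
    hH.contDiffAt.mem_toOpenPartialHomeomorph_source hHd hne
  have hRH : ∀ q, R q = H q := fun q => rfl
  have hH0 : H 0 = 0 := by simp [H, h0]
  have hRt : (0 : ℝ × E) ∈ R.target := by
    have := R.map_source hR0
    rwa [hRH, hH0] at this
  have hs0 : R.symm 0 = 0 := by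
    have := R.left_inv hR0
    rwa [hRH, hH0] at this
  -- Smoothness of the inverse is needed on a neighbourhood, so the derivative must stay invertible
  -- near `0`.
  have hinv : ∀ᶠ q in 𝓝 (0 : ℝ × E), (fderiv ℝ H q) ∈
      range ((↑) : ((ℝ × E) ≃L[ℝ] (ℝ × E)) → ℝ × E →L[ℝ] ℝ × E) := by
    refine (hH.continuous_fderiv (by simp)).continuousAt.eventually_mem
      (ContinuousLinearEquiv.isOpen.mem_nhds ?_)
    rw [hHd.fderiv]
    exact mem_range_self _
  have hev : ∀ᶠ z in 𝓝 (0 : ℝ × E), z ∈ R.target ∧ ContDiffAt ℝ ∞ R.symm z := by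
    have hc : Tendsto R.symm (𝓝 0) (𝓝 0) := by
      have := R.continuousAt_symm hRt
      rwa [ContinuousAt, hs0] at this
    filter_upwards [R.open_target.mem_nhds hRt, hc.eventually hinv] with z hz ⟨e, he⟩
    refine ⟨hz, R.contDiffAt_symm hz (f₀' := e) ?_ hH.contDiffAt⟩
    rw [he]
    exact (hH.differentiable (by simp) _).hasFDerivAt
  have hι : Continuous (fun t : ℝ => (t, (0 : E))) := by fun_prop
  have hev' := (hι.tendsto' 0 0 rfl).eventually hev
  obtain ⟨ε, hε, hball⟩ := Metric.eventually_nhds_iff_ball.1 hev'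
  refine ⟨ε, hε, fun t => (R.symm (t, 0)).2, ?_, ?_, ?_, ?_⟩
  · intro t ht
    have ht' := (hball t (by rw [Real.ball_eq_Ioo]; simpa using ht)).2
    exact (contDiffAt_snd.comp t (ht'.comp t
      (contDiffAt_id.prodMk contDiffAt_const))).contDiffWithinAt
  · change (R.symm 0).2 = 0
    rw [hs0]; rfl
  · have h1 : HasFDerivAt R.symm (((ContinuousLinearEquiv.refl ℝ (ℝ × E)).symm :
        (ℝ × E) ≃L[ℝ] (ℝ × E)) : ℝ × E →L[ℝ] ℝ × E) 0 :=
      R.hasFDerivAt_symm hRt (by rw [hs0]; exact hHd)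
    have h2 : HasDerivAt (fun t : ℝ => (t, (0 : E))) ((1 : ℝ), (0 : E)) 0 :=
      (hasDerivAt_id 0).prodMk (hasDerivAt_const 0 0)
    have h3 : HasDerivAt (fun t : ℝ => R.symm (t, 0)) ((1 : ℝ), (0 : E)) 0 :=
      HasFDerivAt.comp_hasDerivAt (f := fun t : ℝ => (t, (0 : E))) 0 h1 h2
    exact (hasFDerivAt_snd (𝕜 := ℝ) (E := ℝ) (F := E)).comp_hasDerivAt 0 h3
  · intro t ht
    have ht' := (hball t (by rw [Real.ball_eq_Ioo]; simpa using ht)).1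
    have h1 : H (R.symm (t, 0)) = (t, 0) := R.right_inv ht'
    have h2 : (R.symm (t, 0)).1 = t := congrArg Prod.fst h1
    have h3 : Φ (R.symm (t, 0)) = 0 := congrArg Prod.snd h1
    have h4 : R.symm (t, 0) = (t, (R.symm (t, 0)).2) := Prod.ext h2 rfl
    rw [← h4, h3]

theorem exists_margin_of_isCompact {a b : ℝ} {K : Set ℝ} (hK : IsCompact K) (hKs : K ⊆ Ioo a b) :
    ∃ δ > 0, ∀ x, x ≤ a + δ ∨ b - δ ≤ x → x ∉ K := by
  obtain ⟨δ, hδ, h⟩ := hK.exists_cthickening_subset_open isOpen_Ioo hKs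
  refine ⟨δ, hδ, fun x hx hxK => ?_⟩
  have hm : ∀ y, |y - x| ≤ δ → y ∈ Ioo a b := fun y hy =>
    h (Metric.mem_cthickening_of_dist_le y x δ K hxK hy)
  have h1 := (hm (x - δ) (by simp [abs_of_pos hδ])).1
  have h2 := (hm (x + δ) (by simp [abs_of_pos hδ])).2
  rcases hx with hx | hx <;> linarith

theorem exists_cutoff {a b : ℝ} (hab : a < b) {K : Set ℝ} (hK : IsCompact K)
    (hKs : K ⊆ Ioo a b) :
    ∃ χ : ℝ → ℝ, ContDiff ℝ ∞ χ ∧ tsupport χ ⊆ Ioo a b ∧ ∀ x ∈ K, χ x = 1 := by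
  obtain ⟨δ, hδ, h⟩ := exists_margin_of_isCompact hK hKs
  -- The cap keeps the inner radius of the bump positive even if `K` is empty.
  set η := min δ ((b - a) / 4)
  have hη : 0 < η := lt_min hδ (by linarith)
  have hη1 : η ≤ δ := min_le_left _ _
  have hη2 : η ≤ (b - a) / 4 := min_le_right _ _
  let f : ContDiffBump ((a + b) / 2) :=
    ⟨(b - a) / 2 - η, (b - a) / 2 - η / 2, by linarith, by linarith⟩
  refine ⟨f, f.contDiff, ?_, ?_⟩
  · rw [f.tsupport_eq]
    intro x hx
    rw [Real.closedBall_eq_Icc] at hx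
    simp only [f] at hx
    constructor <;> linarith [hx.1, hx.2]
  · intro x hx
    refine f.one_of_mem_closedBall ?_
    rw [Real.closedBall_eq_Icc]
    have h1 := mt (h x) (not_not.2 hx)
    push Not at h1
    simp only [f]
    constructor <;> linarith [h1.1, h1.2]

end Calculus

/-! ### One-sided derivatives on a closed interval. -/

section ParamDeriv

variable {F : Type*} [NormedAddCommGroup F] [NormedSpace ℝ F] {a b : ℝ} {f g : ℝ → F}

theorem contDiffOn_paramDeriv (hab : a < b) (hf : ContDiffOn ℝ ∞ f (Icc a b)) :
    ContDiffOn ℝ ∞ (paramDeriv a b f) (Icc a b) :=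
  ((contDiffOn_infty_iff_derivWithin (uniqueDiffOn_Icc hab)).1 hf).2

theorem hasDerivWithinAt_paramDeriv (hf : ContDiffOn ℝ ∞ f (Icc a b)) {x : ℝ}
    (hx : x ∈ Icc a b) : HasDerivWithinAt f (paramDeriv a b f x) (Icc a b) x :=
  (hf.differentiableOn (by simp) x hx).hasDerivWithinAt

theorem paramDeriv_eq (hab : a < b) {x : ℝ} {f' : F} (hx : x ∈ Icc a b)
    (h : HasDerivWithinAt f f' (Icc a b) x) : paramDeriv a b f x = f' :=
  h.derivWithin (uniqueDiffOn_Icc hab x hx)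

theorem paramDeriv_congr {x : ℝ} (hx : x ∈ Icc a b) (h : ∀ y ∈ Icc a b, f y = g y) :
    paramDeriv a b f x = paramDeriv a b g x :=
  derivWithin_congr h (h x hx)

theorem integral_paramDeriv [CompleteSpace F] (hab : a < b) (hf : ContDiffOn ℝ ∞ f (Icc a b)) :
    ∫ x in a..b, paramDeriv a b f x = f b - f a := by
  refine intervalIntegral.integral_eq_sub_of_hasDerivAt_of_le hab.le hf.continuousOn ?_ ?_
  · intro x hx
    exact (hasDerivWithinAt_paramDeriv hf (Ioo_subset_Icc_self hx)).hasDerivAt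
      (Icc_mem_nhds hx.1 hx.2)
  · exact (contDiffOn_paramDeriv hab hf).continuousOn.intervalIntegrable_of_Icc hab.le

theorem integral_congr_Icc {f g : ℝ → F} (hab : a < b) (h : ∀ x ∈ Icc a b, f x = g x) :
    ∫ x in a..b, f x = ∫ x in a..b, g x :=
  intervalIntegral.integral_congr fun x hx => h x (by rwa [uIcc_of_le hab.le] at hx)

end ParamDeriv

/-! ### Moving a unit vector along the sphere. -/

section Shift

variable {E : Type*} [NormedAddCommGroup E] [InnerProductSpace ℝ E]

/-- The displacement from `T` to the normalization of `T + w`, for a unit vector `T ⊥ w`. -/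
noncomputable def sphereShift (T w : E) : E :=
  ((√(1 + ‖w‖ ^ 2))⁻¹ - 1) • T + (√(1 + ‖w‖ ^ 2))⁻¹ • w

/-- Lets the shift inherit compact support from `w`. -/
theorem sphereShift_zero (T : E) : sphereShift T 0 = 0 := by
  simp [sphereShift]

theorem norm_add_sphereShift {T w : E} (hT : ‖T‖ = 1) (hw : inner ℝ w T = 0) :
    ‖T + sphereShift T w‖ = 1 := by
  have h1 : T + sphereShift T w = (√(1 + ‖w‖ ^ 2))⁻¹ • (T + w) := by
    simp only [sphereShift]; module
  have h2 : ‖T + w‖ = √(1 + ‖w‖ ^ 2) := by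
    rw [← Real.sqrt_sq (norm_nonneg (T + w)), norm_add_sq_real, real_inner_comm, hw, hT]
    simp
  have h3 : 0 < √(1 + ‖w‖ ^ 2) := Real.sqrt_pos.2 (by positivity)
  rw [h1, norm_smul, h2, norm_inv, Real.norm_of_nonneg h3.le, inv_mul_cancel₀ h3.ne']

/-- Normalizing by `√(1 + ‖w‖²)`, which never vanishes, instead of `‖T + w‖` keeps the shift smooth
even where a cut-off `T` is not a unit vector. -/
theorem contDiff_inv_sqrt_one_add_norm_sq :
    ContDiff ℝ ∞ (fun w : E => (√(1 + ‖w‖ ^ 2))⁻¹) := by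
  have h : ∀ w : E, 1 + ‖w‖ ^ 2 ≠ 0 := fun w => by positivity
  refine ContDiff.inv (ContDiff.sqrt ?_ h) fun w => (Real.sqrt_pos.2 (by positivity)).ne'
  exact contDiff_const.add (contDiff_norm_sq ℝ)

theorem contDiff_sphereShift {G : Type*} [NormedAddCommGroup G] [NormedSpace ℝ G]
    {T w : G → E} (hT : ContDiff ℝ ∞ T) (hw : ContDiff ℝ ∞ w) :
    ContDiff ℝ ∞ (fun q => sphereShift (T q) (w q)) := by
  have h := contDiff_inv_sqrt_one_add_norm_sq.comp hw
  exact ((h.sub contDiff_const).smul hT).add (h.smul hw)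

/-- The normalizing factor is even in `s`, so it contributes nothing to first order. -/
theorem hasDerivAt_sphereShift_smul (T w : E) :
    HasDerivAt (fun s : ℝ => sphereShift T (s • w)) w 0 := by
  have h0 : HasDerivAt (fun s : ℝ => 1 + ‖s • w‖ ^ 2) 0 0 := by
    have h1 : HasDerivAt (fun s : ℝ => 1 + s ^ 2 * ‖w‖ ^ 2) 0 0 := by
      simpa using (((hasDerivAt_id (0 : ℝ)).pow 2).mul_const (‖w‖ ^ 2)).const_add 1
    simpa [norm_smul, mul_pow] using h1
  have h2 : HasDerivAt (fun s : ℝ => (√(1 + ‖s • w‖ ^ 2))⁻¹) 0 0 := by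
    simpa using (h0.sqrt (by simp)).fun_inv (by simp)
  have h3 : HasDerivAt (fun s : ℝ => s • w) w 0 := by
    simpa using (hasDerivAt_id (0 : ℝ)).smul_const w
  have h4 := ((h2.sub_const 1).smul_const T).fun_add (h2.fun_smul h3)
  simpa [ElasticCurve.sphereShift] using h4

end Shift

/-! ### Bending energy under a change of the tangent field. -/

section Energy

variable {n : ℕ} {a b : ℝ} {ϱ : ℝ → ℝ} {γ : ℝ → EuclideanSpace ℝ (Fin n)}

theorem unitTangent_eq_paramDeriv (h : ∀ x ∈ Icc a b, ‖paramDeriv a b γ x‖ = 1) :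
    ∀ x ∈ Icc a b, unitTangent a b γ x = paramDeriv a b γ x := by
  intro x hx
  simp [unitTangent, arcDeriv, h x hx]

theorem bendingEnergy_eq (hab : a < b) (h : ∀ x ∈ Icc a b, ‖paramDeriv a b γ x‖ = 1) :
    bendingEnergy a b ϱ γ
      = ∫ x in a..b, 1 / 2 * (ϱ x * ‖paramDeriv a b (paramDeriv a b γ) x‖ ^ 2) := by
  rw [bendingEnergy, intervalIntegral.integral_const_mul]
  congr 1
  refine integral_congr_Icc hab fun x hx => ?_
  have h1 : arcDeriv a b γ (unitTangent a b γ) x = paramDeriv a b (paramDeriv a b γ) x := by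
    rw [arcDeriv, h x hx, paramDeriv_congr hx (unitTangent_eq_paramDeriv h)]
    simp
  rw [h1, h x hx, real_inner_self_eq_norm_sq, mul_one]

theorem contDiffOn_bendingForce (hab : a < b) (hϱ : IsStiffness a b ϱ)
    (hγ : IsArcLengthCurve a b γ) :
    ContDiffOn ℝ ∞ (paramDeriv a b fun y => ϱ y • paramDeriv a b (paramDeriv a b γ) y)
      (Icc a b) :=
  contDiffOn_paramDeriv hab
    (hϱ.smooth.smul (contDiffOn_paramDeriv hab (contDiffOn_paramDeriv hab hγ.smooth)))

theorem hasDerivWithinAt_add_primitive (hγ : ContDiffOn ℝ ∞ γ (Icc a b))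
    {g : ℝ → EuclideanSpace ℝ (Fin n)} (hg : Continuous g) {x : ℝ} (hx : x ∈ Icc a b) :
    HasDerivWithinAt (fun x => γ x + ∫ y in a..x, g y) (paramDeriv a b γ x + g x) (Icc a b) x :=
  (hasDerivWithinAt_paramDeriv hγ hx).add
    (hg.integral_hasStrictDerivAt a x).hasDerivAt.hasDerivWithinAt

theorem paramDeriv_add_primitive (hab : a < b) (hγ : ContDiffOn ℝ ∞ γ (Icc a b))
    {g : ℝ → EuclideanSpace ℝ (Fin n)} (hg : Continuous g) {x : ℝ} (hx : x ∈ Icc a b) :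
    paramDeriv a b (fun x => γ x + ∫ y in a..x, g y) x = paramDeriv a b γ x + g x :=
  paramDeriv_eq hab hx (hasDerivWithinAt_add_primitive hγ hg hx)

/-- Expands `½ ϱ |T' + g'|²` exactly and integrates the cross term by parts; the boundary terms
vanish with `g`. -/
theorem bendingEnergy_add_primitive (hab : a < b) (hϱ : IsStiffness a b ϱ)
    (hγ : IsArcLengthCurve a b γ) {g : ℝ → EuclideanSpace ℝ (Fin n)} (hg : ContDiff ℝ ∞ g)
    (hga : g a = 0) (hgb : g b = 0) (hgn : ∀ x ∈ Icc a b, ‖paramDeriv a b γ x + g x‖ = 1) :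
    bendingEnergy a b ϱ (fun x => γ x + ∫ y in a..x, g y) = bendingEnergy a b ϱ γ
      + ((∫ x in a..b, 1 / 2 * (ϱ x * ‖deriv g x‖ ^ 2))
        - ∫ x in a..b, inner ℝ
          (paramDeriv a b (fun y => ϱ y • paramDeriv a b (paramDeriv a b γ) y) x) (g x)) := by
  have hΓ : ∀ x ∈ Icc a b, paramDeriv a b (fun x => γ x + ∫ y in a..x, g y) x
      = paramDeriv a b γ x + g x := fun x hx =>
    paramDeriv_add_primitive hab hγ.smooth hg.continuous hx
  have hT := contDiffOn_paramDeriv hab hγ.smooth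
  have hT1 := contDiffOn_paramDeriv hab hT
  have hgd : Continuous (deriv g) := hg.continuous_deriv (by simp)
  have hM : ContDiffOn ℝ ∞ (fun y => ϱ y • paramDeriv a b (paramDeriv a b γ) y) (Icc a b) :=
    hϱ.smooth.smul hT1
  have hW := contDiffOn_bendingForce hab hϱ hγ
  rw [bendingEnergy_eq hab (fun x hx => by rw [hΓ x hx, hgn x hx]),
    bendingEnergy_eq hab hγ.unit_speed]
  have hΓ2 : ∀ x ∈ Icc a b, paramDeriv a b (paramDeriv a b fun x => γ x + ∫ y in a..x, g y) x
      = paramDeriv a b (paramDeriv a b γ) x + deriv g x := by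
    intro x hx
    rw [paramDeriv_congr hx hΓ]
    exact paramDeriv_eq hab hx ((hasDerivWithinAt_paramDeriv hT hx).add
      (hg.differentiable (by simp) x).hasDerivAt.hasDerivWithinAt)
  have hbd : ∀ x ∈ Icc a b,
      paramDeriv a b (fun x => inner ℝ (ϱ x • paramDeriv a b (paramDeriv a b γ) x) (g x)) x
      = inner ℝ (ϱ x • paramDeriv a b (paramDeriv a b γ) x) (deriv g x)
        + inner ℝ (paramDeriv a b (fun y => ϱ y • paramDeriv a b (paramDeriv a b γ) y) x)
          (g x) := by
    intro x hx
    exact paramDeriv_eq hab hx ((hasDerivWithinAt_paramDeriv hM hx).inner ℝ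
      (hg.differentiable (by simp) x).hasDerivAt.hasDerivWithinAt)
  have hparts := integral_paramDeriv hab (hM.inner ℝ hg.contDiffOn)
  rw [hga, hgb, inner_zero_right, inner_zero_right, sub_zero,
    integral_congr_Icc hab hbd] at hparts
  have i1 : IntervalIntegrable (fun x => inner ℝ (ϱ x • paramDeriv a b (paramDeriv a b γ) x)
      (deriv g x)) volume a b :=
    (hM.continuousOn.inner hgd.continuousOn).intervalIntegrable_of_Icc hab.le
  have i2 : IntervalIntegrable (fun x => inner ℝ
      (paramDeriv a b (fun y => ϱ y • paramDeriv a b (paramDeriv a b γ) y) x) (g x))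
      volume a b :=
    (hW.continuousOn.inner hg.continuous.continuousOn).intervalIntegrable_of_Icc hab.le
  have i3 : IntervalIntegrable (fun x => 1 / 2 * (ϱ x * ‖deriv g x‖ ^ 2)) volume a b :=
    ((continuousOn_const.mul (hϱ.smooth.continuousOn.mul
      (hgd.continuousOn.norm.pow 2)))).intervalIntegrable_of_Icc hab.le
  have i4 : IntervalIntegrable
      (fun x => 1 / 2 * (ϱ x * ‖paramDeriv a b (paramDeriv a b γ) x‖ ^ 2)) volume a b :=
    ((continuousOn_const.mul (hϱ.smooth.continuousOn.mul
      (hT1.continuousOn.norm.pow 2)))).intervalIntegrable_of_Icc hab.le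
  rw [intervalIntegral.integral_add i1 i2] at hparts
  rw [integral_congr_Icc (g := fun x => 1 / 2 * (ϱ x * ‖paramDeriv a b (paramDeriv a b γ) x‖ ^ 2)
      + (1 / 2 * (ϱ x * ‖deriv g x‖ ^ 2)
        + inner ℝ (ϱ x • paramDeriv a b (paramDeriv a b γ) x) (deriv g x))) hab,
    intervalIntegral.integral_add i4 (i3.add i1), intervalIntegral.integral_add i3 i1]
  · linarith
  · intro x hx
    rw [hΓ2 x hx, norm_add_sq_real, real_inner_smul_left]
    ring

end Energy

/-- Smooth vector fields with compact support in `(a, b)` that are orthogonal to `T`. -/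
def normalFields (a b : ℝ) {E : Type*} [NormedAddCommGroup E] [InnerProductSpace ℝ E]
    (T : ℝ → E) : Submodule ℝ (ℝ → E) where
  carrier := {τ | ContDiff ℝ ∞ τ ∧ (∃ K, IsCompact K ∧ K ⊆ Ioo a b ∧ ∀ x ∉ K, τ x = 0) ∧
    ∀ x ∈ Icc a b, inner ℝ (τ x) (T x) = 0}
  zero_mem' := ⟨contDiff_const, ⟨∅, isCompact_empty, empty_subset _, fun _ _ => rfl⟩, by simp⟩
  add_mem' := by
    rintro τ σ ⟨hτ, ⟨K, hK, hKs, hK0⟩, hτT⟩ ⟨hσ, ⟨L, hL, hLs, hL0⟩, hσT⟩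
    refine ⟨hτ.add hσ, ⟨K ∪ L, hK.union hL, union_subset hKs hLs, fun x hx => ?_⟩, fun x hx => ?_⟩
    · rw [mem_union, not_or] at hx
      simp [hK0 x hx.1, hL0 x hx.2]
    · simp [inner_add_left, hτT x hx, hσT x hx]
  smul_mem' := by
    rintro c τ ⟨hτ, ⟨K, hK, hKs, hK0⟩, hτT⟩
    refine ⟨contDiff_const.smul hτ, ⟨K, hK, hKs, fun x hx => ?_⟩, fun x hx => ?_⟩
    · simp [hK0 x hx]
    · simp [real_inner_smul_left, hτT x hx]

/-! ### First variation under the closing condition. -/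

section Variation

variable {n : ℕ} {a b : ℝ} {ϱ : ℝ → ℝ} {γ : ℝ → EuclideanSpace ℝ (Fin n)}

/-- For a smooth family `g` of compactly supported fields, the fields `∂ₓ g` and the energy of the
variation `p ↦ g p` of the tangent field, up to a constant, are smooth. -/
theorem contDiff_energy_variation {P : Type*} [NormedAddCommGroup P] [NormedSpace ℝ P]
    {K : Set ℝ} (hK : IsCompact K) (hKs : K ⊆ Ioo a b)
    {g : P → ℝ → EuclideanSpace ℝ (Fin n)} (hg : ContDiff ℝ ∞ (fun q : P × ℝ => g q.1 q.2))
    (hgs : ∀ p, ∀ x ∉ K, g p x = 0) {r : ℝ → ℝ} (hr : ContDiff ℝ ∞ r)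
    {W : ℝ → EuclideanSpace ℝ (Fin n)} (hW : ContDiff ℝ ∞ W) :
    ContDiff ℝ ∞ (fun q : P × ℝ => deriv (g q.1) q.2) ∧
    (∀ p, ∀ x ∉ K, deriv (g p) x = 0) ∧
    ContDiff ℝ ∞ (fun p : P => (∫ x in a..b, 1 / 2 * (r x * ‖deriv (g p) x‖ ^ 2))
      - ∫ x in a..b, inner ℝ (W x) (g p x)) := by
  have hd : ContDiff ℝ ∞ (fun q : P × ℝ => deriv (g q.1) q.2) := by
    have h1 : (fun q : P × ℝ => deriv (g q.1) q.2)
        = fun q => fderiv ℝ (fun q : P × ℝ => g q.1 q.2) q (0, 1) := by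
      ext1 q
      have h2 : HasDerivAt (fun x : ℝ => (q.1, x)) ((0 : P), (1 : ℝ)) q.2 :=
        (hasDerivAt_const q.2 q.1).prodMk (hasDerivAt_id q.2)
      exact ((hg.differentiable (by simp) (q.1, q.2)).hasFDerivAt.comp_hasDerivAt q.2 h2).deriv
    rw [h1]
    exact (hg.fderiv_right (by simp)).clm_apply contDiff_const
  have hd0 : ∀ p, ∀ x ∉ K, deriv (g p) x = 0 := by
    intro p x hx
    have h1 : g p =ᶠ[𝓝 x] fun _ => 0 := by
      filter_upwards [hK.isClosed.isOpen_compl.mem_nhds hx] with y hy using hgs p y hy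
    rw [h1.deriv_eq, deriv_const]
  refine ⟨hd, hd0, ContDiff.sub ?_ ?_⟩
  · refine contDiff_integral_of_compact_support hK hKs
      (g := fun p x => 1 / 2 * (r x * ‖deriv (g p) x‖ ^ 2)) ?_ fun p x hx => by simp [hd0 p x hx]
    exact contDiff_const.mul ((hr.comp contDiff_snd).mul (hd.norm_sq ℝ))
  · refine contDiff_integral_of_compact_support hK hKs
      (g := fun p x => inner ℝ (W x) (g p x)) ?_ fun p x hx => by simp [hgs p x hx]
    exact (hW.comp contDiff_snd).inner ℝ hg

/-- As `g 0 = 0`, the quadratic term has derivative zero and only the linear term survives. -/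
theorem hasDerivAt_energy_variation
    {K : Set ℝ} (hK : IsCompact K) (hKs : K ⊆ Ioo a b)
    {g : ℝ → ℝ → EuclideanSpace ℝ (Fin n)} (hg : ContDiff ℝ ∞ (fun q : ℝ × ℝ => g q.1 q.2))
    (hgs : ∀ p, ∀ x ∉ K, g p x = 0) {r : ℝ → ℝ} (hr : ContDiff ℝ ∞ r)
    {W τ : ℝ → EuclideanSpace ℝ (Fin n)} (hW : ContDiff ℝ ∞ W) (hg0 : ∀ x, g 0 x = 0)
    (hgτ : ∀ x, HasDerivAt (fun s => g s x) (τ x) 0) :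
    HasDerivAt (fun s => (∫ x in a..b, 1 / 2 * (r x * ‖deriv (g s) x‖ ^ 2))
      - ∫ x in a..b, inner ℝ (W x) (g s x)) (-∫ x in a..b, inner ℝ (W x) (τ x)) 0 := by
  obtain ⟨hd, -, -⟩ := contDiff_energy_variation hK hKs hg hgs hr hW
  have h1 : HasDerivAt (fun s => ∫ x in a..b, 1 / 2 * (r x * ‖deriv (g s) x‖ ^ 2))
      (∫ x in a..b, (0 : ℝ)) 0 := by
    refine hasDerivAt_integral_of_contDiff (h := fun s x => 1 / 2 * (r x * ‖deriv (g s) x‖ ^ 2))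
      (contDiff_const.mul ((hr.comp contDiff_snd).mul (hd.norm_sq ℝ))) fun x => ?_
    have h2 : DifferentiableAt ℝ (fun s => deriv (g s) x) 0 :=
      (hd.comp (contDiff_id.prodMk contDiff_const :
        ContDiff ℝ ∞ fun s : ℝ => (s, x))).differentiable (by simp) 0
    have h3 : deriv (g 0) x = 0 := by
      rw [funext hg0, deriv_const]
    simpa only [h3, inner_zero_left, mul_zero] using ((h2.hasDerivAt.norm_sq.const_mul (r x)).const_mul (1 / 2))
  have h4 : HasDerivAt (fun s => ∫ x in a..b, inner ℝ (W x) (g s x))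
      (∫ x in a..b, inner ℝ (W x) (τ x)) 0 := by
    refine hasDerivAt_integral_of_contDiff (h := fun s x => inner ℝ (W x) (g s x))
      ((hW.comp contDiff_snd).inner ℝ hg) fun x => ?_
    simpa using (hasDerivAt_const (0 : ℝ) (W x)).inner ℝ (hgτ x)
  simpa using h1.fun_sub h4

/-- A smooth family of unit tangent fields, with fixed values near the end points, whose integral
does not depend on the parameter, gives an admissible variation. -/
theorem IsArcLengthCurve.isAdmissibleVariation (hab : a < b) (hγ : IsArcLengthCurve a b γ)
    {P : Type*} [NormedAddCommGroup P] [NormedSpace ℝ P]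
    {K : Set ℝ} (hK : IsCompact K) (hKs : K ⊆ Ioo a b)
    {g : P → ℝ → EuclideanSpace ℝ (Fin n)} (hg : ContDiff ℝ ∞ (fun q : P × ℝ => g q.1 q.2))
    (hg0 : ∀ p, ∀ x ∉ K, g p x = 0) (hgn : ∀ p, ∀ x ∈ Icc a b, ‖paramDeriv a b γ x + g p x‖ = 1)
    {ε : ℝ} (hε : 0 < ε) {c : ℝ → P} (hc : ContDiffOn ℝ ∞ c (Icc (-ε) ε))
    (hc0 : ∀ x, g (c 0) x = 0) (hcg : ∀ t ∈ Icc (-ε) ε, ∫ x in a..b, g (c t) x = 0) :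
    IsAdmissibleVariation a b γ ε (fun t x => γ x + ∫ y in a..x, g (c t) y) := by
  have hgp : ∀ p, Continuous (g p) := fun p =>
    hg.continuous.comp (Continuous.prodMk_right p)
  have hprim := contDiff_primitive_of_compact_support hK hKs hg hg0
  obtain ⟨δ, hδ, hδK⟩ := exists_margin_of_isCompact hK hKs
  refine ⟨hε, ?_, ?_, ⟨δ, hδ, ?_⟩, ?_⟩
  · have h1 : ContDiffOn ℝ ∞ (fun p : ℝ × ℝ => γ p.2) (Icc (-ε) ε ×ˢ Icc a b) :=
      hγ.smooth.comp contDiff_snd.contDiffOn fun p hp => hp.2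
    have h2 : ContDiffOn ℝ ∞ (fun p : ℝ × ℝ => c p.1) (Icc (-ε) ε ×ˢ Icc a b) :=
      hc.comp contDiff_fst.contDiffOn fun p hp => hp.1
    exact h1.add (hprim.comp_contDiffOn (h2.prodMk contDiff_snd.contDiffOn))
  · intro x _
    simp [hc0]
  · intro t ht x hx hxδ
    have hzero : ∫ y in a..x, g (c t) y = 0 := by
      rcases hxδ with h | h
      · rw [intervalIntegral.integral_zero_ae]
        refine Eventually.of_forall fun y hy => hg0 _ y (hδK y (Or.inl ?_))
        rw [uIoc_of_le hx.1] at hy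
        exact hy.2.trans h
      -- Near `b` the primitive vanishes because the full integral does: this is where the closing
      -- condition enters.
      · have h1 : ∫ y in x..b, g (c t) y = 0 := by
          rw [intervalIntegral.integral_zero_ae]
          refine Eventually.of_forall fun y hy => hg0 _ y (hδK y (Or.inr ?_))
          rw [uIoc_of_le hx.2] at hy
          exact h.trans hy.1.le
        have h2 := hcg t ht
        rwa [← intervalIntegral.integral_add_adjacent_intervals
          ((hgp _).intervalIntegrable a x) ((hgp _).intervalIntegrable x b), h1, add_zero] at h2
    simp [hzero]
  · intro t _ x hx
    rw [paramDeriv_add_primitive hab hγ.smooth (hgp _) hx, hγ.unit_speed x hx]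
    exact hgn _ x hx

theorem fderiv_apply_eq_of_line {P G : Type*} [NormedAddCommGroup P] [NormedSpace ℝ P]
    [NormedAddCommGroup G] [NormedSpace ℝ G] {f : P → G} (hf : ContDiff ℝ ∞ f) {p : P} {v : G}
    (h : HasDerivAt (fun s : ℝ => f (s • p)) v 0) : fderiv ℝ f 0 p = v := by
  have h1 : HasFDerivAt f (fderiv ℝ f 0) ((0 : ℝ) • p) := by
    rw [zero_smul]; exact (hf.differentiable (by simp) 0).hasFDerivAt
  have h2 : HasDerivAt (fun s : ℝ => s • p) p 0 := by
    simpa using (hasDerivAt_id (0 : ℝ)).smul_const p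
  exact (h1.comp_hasDerivAt (f := fun s : ℝ => s • p) 0 h2).unique h

/-- First variation for a family of unit tangent fields for which the closing condition
`∫ g p = 0` can be solved for the second component of `p`. -/
theorem IsElastic.integral_inner_force_eq_zero_of_family (hab : a < b) (hϱ : IsStiffness a b ϱ)
    (hγ : IsElastic a b ϱ γ) {K : Set ℝ} (hK : IsCompact K) (hKs : K ⊆ Ioo a b)
    {g w : ℝ × EuclideanSpace ℝ (Fin n) → ℝ → EuclideanSpace ℝ (Fin n)}
    (hg : ContDiff ℝ ∞ (fun q : (ℝ × EuclideanSpace ℝ (Fin n)) × ℝ => g q.1 q.2))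
    (hg0 : ∀ p, ∀ x ∉ K, g p x = 0) (hgn : ∀ p, ∀ x ∈ Icc a b, ‖paramDeriv a b γ x + g p x‖ = 1)
    (hgz : ∀ x, g 0 x = 0) (hgd : ∀ p x, HasDerivAt (fun s : ℝ => g (s • p) x) (w p x) 0)
    (hw0 : ∀ p, ∀ x ∉ K, w p x = 0) (hw : ∀ p, ∫ x in a..b, w p x = p.2) :
    ∫ x in a..b, inner ℝ
      (paramDeriv a b (fun y => ϱ y • paramDeriv a b (paramDeriv a b γ) y) x) (w (1, 0) x)
        = 0 := by
  have hγ1 := hγ.arcLength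
  have hW := contDiffOn_bendingForce hab hϱ hγ1
  set W := paramDeriv a b (fun y => ϱ y • paramDeriv a b (paramDeriv a b γ) y) with hWdef
  have haK : a ∉ K := fun h => lt_irrefl _ (hKs h).1
  have hbK : b ∉ K := fun h => lt_irrefl _ (hKs h).2
  -- Replacing `W` and `ϱ` by `χ W` and `χ ϱ` makes them globally smooth without changing the
  -- integrals below: `χ = 1` on `K`, and the variation vanishes off `K`.
  obtain ⟨χ, hχ, hχs, hχ1⟩ := exists_cutoff hab hK hKs
  have hgp : ∀ p, ContDiff ℝ ∞ (g p) := fun p =>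
    hg.comp (contDiff_const.prodMk contDiff_id : ContDiff ℝ ∞ fun x : ℝ => (p, x))
  have hgline : ∀ p, ContDiff ℝ ∞ (fun q : ℝ × ℝ => g (q.1 • p) q.2) := fun p =>
    hg.comp ((contDiff_fst.smul contDiff_const).prodMk contDiff_snd)
  have hΦ : ContDiff ℝ ∞ fun p => ∫ x in a..b, g p x :=
    contDiff_integral_of_compact_support hK hKs hg hg0
  have hΦd : fderiv ℝ (fun p => ∫ x in a..b, g p x) 0
      = ContinuousLinearMap.snd ℝ ℝ (EuclideanSpace ℝ (Fin n)) := by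
    refine ContinuousLinearMap.ext fun p => fderiv_apply_eq_of_line hΦ ?_
    rw [ContinuousLinearMap.coe_snd', ← hw p]
    exact hasDerivAt_integral_of_contDiff (h := fun s x => g (s • p) x) (hgline p) (hgd p)
  obtain ⟨ε, hε, u, hu, hu0, hud, huΦ⟩ := exists_implicit_curve hΦ (by simp [hgz]) hΦd
  have hεs : Icc (-(ε / 2)) (ε / 2) ⊆ Ioo (-ε) ε := fun t ht =>
    ⟨by linarith [ht.1], by linarith [ht.2]⟩
  have hu00 : ((0 : ℝ), u 0) = 0 := by rw [hu0]; rfl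
  have hcrit := hγ.critical _ _ (hγ1.isAdmissibleVariation hab hK hKs hg hg0 hgn (half_pos hε)
    (c := fun t => (t, u t)) (contDiffOn_id.prodMk (hu.mono hεs))
    (fun x => by simp only [hu00, hgz]) (fun t ht => huΦ t (hεs ht)))
  have hχW := contDiff_smul_of_tsupport_subset hχ hχs hW
  have hχϱ := contDiff_smul_of_tsupport_subset hχ hχs hϱ.smooth
  obtain ⟨-, hdg0, hen⟩ := contDiff_energy_variation hK hKs hg hg0 hχϱ hχW
  have hed := fderiv_apply_eq_of_line hen (p := (1, 0))
    (hasDerivAt_energy_variation hK hKs (g := fun s => g (s • (1, 0))) (hgline _)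
      (fun s => hg0 _) hχϱ hχW (fun x => by simp [hgz]) (hgd _))
  have henergy : ∀ p, bendingEnergy a b ϱ (fun x => γ x + ∫ y in a..x, g p y)
      = bendingEnergy a b ϱ γ + ((∫ x in a..b, 1 / 2 * ((χ x • ϱ x) * ‖deriv (g p) x‖ ^ 2))
        - ∫ x in a..b, inner ℝ (χ x • W x) (g p x)) := by
    intro p
    rw [bendingEnergy_add_primitive hab hϱ hγ1 (hgp _) (hg0 _ a haK) (hg0 _ b hbK) (hgn _),
      ← hWdef]
    congr 2
    · refine integral_congr_Icc hab fun x _ => ?_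
      by_cases hx : x ∈ K
      · simp [hχ1 x hx]
      · simp [hdg0 _ x hx]
    · refine integral_congr_Icc hab fun x _ => ?_
      by_cases hx : x ∈ K
      · rw [hχ1 x hx, one_smul]
      · rw [hg0 _ x hx, inner_zero_right, inner_zero_right]
  simp only [henergy] at hcrit
  set e : ℝ × EuclideanSpace ℝ (Fin n) → ℝ := fun p =>
    (∫ x in a..b, 1 / 2 * ((χ x • ϱ x) * ‖deriv (g p) x‖ ^ 2))
      - ∫ x in a..b, inner ℝ (χ x • W x) (g p x) with hedef
  -- The closed path leaves `0` with velocity `(1, 0)`, so the correction `u` does not affect the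
  -- first variation.
  have hpath : HasDerivAt (fun t : ℝ => (t, u t))
      ((1 : ℝ), (0 : EuclideanSpace ℝ (Fin n))) 0 := (hasDerivAt_id 0).prodMk hud
  have hed2 : HasFDerivAt e (fderiv ℝ e 0) ((0 : ℝ), u 0) := by
    rw [hu00]; exact (hen.differentiable (by simp) 0).hasFDerivAt
  have h5 := ((hed2.comp_hasDerivAt (f := fun t : ℝ => (t, u t)) 0 hpath).const_add
    (bendingEnergy a b ϱ γ)).unique hcrit
  rw [hed, neg_eq_zero] at h5
  rw [← h5]
  refine integral_congr_Icc hab fun x _ => ?_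
  by_cases hx : x ∈ K
  · rw [hχ1 x hx, one_smul]
  · rw [hw0 _ x hx, inner_zero_right, inner_zero_right]

/-- The first variation of the bending energy of an elastic curve vanishes in directions of
vanishing integral, provided that the closing condition is regular. -/
theorem IsElastic.integral_inner_force_eq_zero (hab : a < b) (hϱ : IsStiffness a b ϱ)
    (hγ : IsElastic a b ϱ γ) {σ : Fin n → ℝ → EuclideanSpace ℝ (Fin n)}
    (hσ : ∀ i, σ i ∈ normalFields a b (paramDeriv a b γ))
    (hσi : ∀ i, ∫ x in a..b, σ i x = EuclideanSpace.single i 1)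
    {τ : ℝ → EuclideanSpace ℝ (Fin n)} (hτ : τ ∈ normalFields a b (paramDeriv a b γ))
    (hτi : ∫ x in a..b, τ x = 0) :
    ∫ x in a..b, inner ℝ
      (paramDeriv a b (fun y => ϱ y • paramDeriv a b (paramDeriv a b γ) y) x) (τ x) = 0 := by
  have hγ1 := hγ.arcLength
  have hT : ContDiffOn ℝ ∞ (paramDeriv a b γ) (Icc a b) := contDiffOn_paramDeriv hab hγ1.smooth
  obtain ⟨hτs, ⟨K₀, hK₀, hK₀s, hτ0⟩, hτT⟩ := hτ
  have hσs : ∀ i, ContDiff ℝ ∞ (σ i) := fun i => (hσ i).1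
  have hσT : ∀ i, ∀ x ∈ Icc a b, inner ℝ (σ i x) (paramDeriv a b γ x) = 0 := fun i => (hσ i).2.2
  choose L hL hLs hL0 using fun i => (hσ i).2.1
  have hK : IsCompact (K₀ ∪ ⋃ i, L i) := hK₀.union (isCompact_iUnion hL)
  have hKs : (K₀ ∪ ⋃ i, L i) ⊆ Ioo a b := union_subset hK₀s (iUnion_subset hLs)
  obtain ⟨χ, hχ, hχs, hχ1⟩ := exists_cutoff hab hK hKs
  have hχT := contDiff_smul_of_tsupport_subset hχ hχs hT
  -- The first parameter follows `τ`; the fields `σ i` supply the freedom to restore the closing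
  -- condition, so that `∫ w p = p.2`.
  obtain ⟨w, hw⟩ : ∃ w : ℝ × EuclideanSpace ℝ (Fin n) → ℝ → EuclideanSpace ℝ (Fin n),
      w = fun p x => p.1 • τ x + ∑ i, p.2 i • σ i x := ⟨_, rfl⟩
  have hw0 : ∀ p, ∀ x ∉ K₀ ∪ ⋃ i, L i, w p x = 0 := by
    intro p x hx
    simp only [mem_union, mem_iUnion, not_or, not_exists] at hx
    simp [hw, hτ0 x hx.1, fun i => hL0 i x (hx.2 i)]
  have hwT : ∀ p, ∀ x ∈ Icc a b, inner ℝ (w p x) (paramDeriv a b γ x) = 0 := by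
    intro p x hx
    simp [hw, inner_add_left, sum_inner, real_inner_smul_left, hτT x hx, fun i => hσT i x hx]
  have hws : ContDiff ℝ ∞ (fun q : (ℝ × EuclideanSpace ℝ (Fin n)) × ℝ => w q.1 q.2) := by
    simp only [hw]
    fun_prop
  have hwsmul : ∀ (s : ℝ) p x, w (s • p) x = s • w p x := by
    intro s p x
    simp [hw, mul_smul, Finset.smul_sum]
  have hwz : ∀ x, w 0 x = 0 := fun x => by simp [hw]
  have hwi : ∀ p, ∫ x in a..b, w p x = p.2 := by
    intro p
    have i1 : IntervalIntegrable (fun x => p.1 • τ x) volume a b :=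
      (hτs.continuous.const_smul p.1).intervalIntegrable _ _
    have i2 : ∀ i ∈ Finset.univ, IntervalIntegrable (fun x => p.2 i • σ i x) volume a b :=
      fun i _ => ((hσs i).continuous.const_smul (p.2 i)).intervalIntegrable _ _
    have i3 : IntervalIntegrable (fun x => ∑ i, p.2 i • σ i x) volume a b :=
      (continuous_finsetSum _ fun i _ =>
        (hσs i).continuous.const_smul (p.2 i)).intervalIntegrable _ _
    simp only [hw]
    rw [intervalIntegral.integral_add i1 i3, intervalIntegral.integral_finsetSum i2,
      intervalIntegral.integral_smul, hτi, smul_zero, zero_add]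
    simp only [intervalIntegral.integral_smul, hσi]
    ext j
    simp [Pi.single_apply]
  have h1 : w (1, 0) = τ := by
    funext x
    simp [hw]
  rw [← h1]
  clear hw
  refine hγ.integral_inner_force_eq_zero_of_family hab hϱ hK hKs
    (g := fun p x => sphereShift (χ x • paramDeriv a b γ x) (w p x)) (w := w)
    (contDiff_sphereShift (hχT.comp contDiff_snd) hws) ?_ ?_ ?_ ?_ hw0 hwi
  · intro p x hx
    simp only [hw0 p x hx, sphereShift_zero]
  · intro p x hx
    by_cases hxK : x ∈ K₀ ∪ ⋃ i, L i
    · rw [hχ1 x hxK, one_smul]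
      exact norm_add_sphereShift (hγ1.unit_speed x hx) (hwT p x hx)
    · rw [hw0 p x hxK, sphereShift_zero, add_zero]
      exact hγ1.unit_speed x hx
  · intro x
    simp only [hwz, sphereShift_zero]
  · intro p x
    simp only [hwsmul]
    exact hasDerivAt_sphereShift_smul _ _

end Variation

/-! ### Testing against normal fields. -/

section NormalFields

variable {E : Type*} [NormedAddCommGroup E] [InnerProductSpace ℝ E] {a b : ℝ} {T : ℝ → E}

/-- Testing with `φ Z`, where `Z` is the part of `Y` normal to `T`, gives `∫ φ |Z|² = 0` for every
bump `φ`. -/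
theorem eq_inner_smul_of_integral_eq_zero (hab : a < b) (hT : ContDiffOn ℝ ∞ T (Icc a b))
    (hT1 : ∀ x ∈ Icc a b, ‖T x‖ = 1) {Y : ℝ → E} (hY : ContDiffOn ℝ ∞ Y (Icc a b))
    (h : ∀ τ ∈ normalFields a b T, ∫ x in a..b, inner ℝ (Y x) (τ x) = 0) :
    ∀ x ∈ Icc a b, Y x = inner ℝ (Y x) (T x) • T x := by
  set Z : ℝ → E := fun x => Y x - inner ℝ (Y x) (T x) • T x with hZdef
  have hZ : ContDiffOn ℝ ∞ Z (Icc a b) := hY.sub ((hY.inner ℝ hT).smul hT)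
  have hZT : ∀ x ∈ Icc a b, inner ℝ (Z x) (T x) = 0 := by
    intro x hx
    simp [hZdef, inner_sub_left, real_inner_smul_left, hT1 x hx]
  have key := eqOn_zero_of_integral_mul_eq_zero hab (f := fun x => ‖Z x‖ ^ 2)
    (hZ.continuousOn.norm.pow 2) (fun φ hφ hc hs => by
      rw [← h (fun x => φ x • Z x) ⟨contDiff_smul_of_tsupport_subset hφ hs hZ,
        ⟨tsupport φ, hc, hs, fun x hx => by simp [image_eq_zero_of_notMem_tsupport hx]⟩,
        fun x hx => by simp [real_inner_smul_left, hZT x hx]⟩]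
      refine integral_congr_Icc hab fun x hx => ?_
      have h1 : Y x = Z x + inner ℝ (Y x) (T x) • T x := by simp [hZdef]
      rw [real_inner_smul_right, h1, inner_add_left, real_inner_smul_left,
        real_inner_comm (Z x) (T x), hZT x hx, real_inner_self_eq_norm_sq]
      simp)
  intro x hx
  have h2 : Z x = 0 := by simpa using key x hx
  exact sub_eq_zero.1 h2

theorem inner_paramDeriv_add_eq_zero (hab : a < b) {f g : ℝ → E}
    (hf : ContDiffOn ℝ ∞ f (Icc a b)) (hg : ContDiffOn ℝ ∞ g (Icc a b)) {c : ℝ}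
    (h : ∀ x ∈ Icc a b, inner ℝ (f x) (g x) = c) {x : ℝ} (hx : x ∈ Icc a b) :
    inner ℝ (f x) (paramDeriv a b g x) + inner ℝ (paramDeriv a b f x) (g x) = 0 := by
  have h1 := paramDeriv_eq hab hx ((hasDerivWithinAt_paramDeriv hf hx).inner ℝ
    (hasDerivWithinAt_paramDeriv hg hx))
  rw [← h1, paramDeriv_congr hx h]
  exact paramDeriv_eq hab hx (hasDerivWithinAt_const x _ c)

theorem inner_paramDeriv_self_eq_zero (hab : a < b) (hT : ContDiffOn ℝ ∞ T (Icc a b))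
    (hT1 : ∀ x ∈ Icc a b, ‖T x‖ = 1) {x : ℝ} (hx : x ∈ Icc a b) :
    inner ℝ (paramDeriv a b T x) (T x) = 0 := by
  have h := inner_paramDeriv_add_eq_zero hab hT hT (c := 1)
    (fun y hy => by rw [real_inner_self_eq_norm_sq, hT1 y hy, one_pow]) hx
  rw [real_inner_comm] at h
  linarith

theorem inner_paramDeriv_paramDeriv_self (hab : a < b) (hT : ContDiffOn ℝ ∞ T (Icc a b))
    (hT1 : ∀ x ∈ Icc a b, ‖T x‖ = 1) {x : ℝ} (hx : x ∈ Icc a b) :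
    inner ℝ (paramDeriv a b (paramDeriv a b T) x) (T x)
      = -inner ℝ (paramDeriv a b T x) (paramDeriv a b T x) := by
  have h := inner_paramDeriv_add_eq_zero hab (contDiffOn_paramDeriv hab hT) hT (c := 0)
    (fun y hy => inner_paramDeriv_self_eq_zero hab hT hT1 hy) hx
  linarith

/-- As `T' ⊥ T`, also `⟨A, T'⟩ = 0`; differentiating `A = ⟨A, T⟩ T` leaves `0 = ⟨A, T⟩ T'`, and `⟨A,
T⟩ ≠ 0`. -/
theorem paramDeriv_eq_zero_of_eq_inner_smul (hab : a < b) (hT : ContDiffOn ℝ ∞ T (Icc a b))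
    (hT1 : ∀ x ∈ Icc a b, ‖T x‖ = 1) {A : E} (hA : A ≠ 0)
    (h : ∀ x ∈ Icc a b, A = inner ℝ A (T x) • T x) {x : ℝ} (hx : x ∈ Icc a b) :
    paramDeriv a b T x = 0 := by
  have h0 : inner ℝ A (paramDeriv a b T x) = 0 := by
    rw [h x hx, real_inner_smul_left, real_inner_comm (paramDeriv a b T x) (T x),
      inner_paramDeriv_self_eq_zero hab hT hT1 hx, mul_zero]
  have hd := paramDeriv_eq hab hx ((((hasDerivWithinAt_const x (Icc a b) A).inner ℝ
    (hasDerivWithinAt_paramDeriv hT hx))).fun_smul (hasDerivWithinAt_paramDeriv hT hx))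
  rw [← paramDeriv_congr hx h, paramDeriv_eq hab hx (hasDerivWithinAt_const x _ A)] at hd
  simp only [h0, inner_zero_left, add_zero, zero_smul] at hd
  refine (smul_eq_zero.1 hd.symm).resolve_left fun h1 => hA ?_
  rw [h x hx, h1, zero_smul]

/-- Either the unit field `T` is constant, or the integral of fields normal to `T` takes every
value. -/
theorem paramDeriv_eq_zero_or_integral_surjective [FiniteDimensional ℝ E] (hab : a < b)
    (hT : ContDiffOn ℝ ∞ T (Icc a b)) (hT1 : ∀ x ∈ Icc a b, ‖T x‖ = 1) :
    (∀ x ∈ Icc a b, paramDeriv a b T x = 0) ∨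
      ∀ v : E, ∃ τ ∈ normalFields a b T, ∫ x in a..b, τ x = v := by
  have hi : ∀ τ ∈ normalFields a b T, IntervalIntegrable τ volume a b := fun τ hτ =>
    hτ.1.continuous.intervalIntegrable _ _
  let J : normalFields a b T →ₗ[ℝ] E :=
    { toFun := fun τ => ∫ x in a..b, (τ : ℝ → E) x
      map_add' := fun τ σ => intervalIntegral.integral_add (hi τ τ.2) (hi σ σ.2)
      map_smul' := fun c τ => intervalIntegral.integral_smul c _ }
  by_cases hJ : J.range = ⊤
  · refine Or.inr fun v => ?_
    obtain ⟨τ, hτ⟩ := LinearMap.range_eq_top.1 hJ v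
    exact ⟨τ, τ.2, hτ⟩
  · refine Or.inl fun x hx => ?_
    -- A nonzero `A` orthogonal to all integrals of normal fields must be parallel to `T`
    -- everywhere.
    obtain ⟨A, hA, hA0⟩ := Submodule.exists_mem_ne_zero_of_ne_bot
      (mt (Submodule.orthogonal_eq_bot_iff (K := J.range)).1 hJ)
    refine paramDeriv_eq_zero_of_eq_inner_smul hab hT hT1 hA0
      (eq_inner_smul_of_integral_eq_zero hab hT hT1 contDiffOn_const fun τ hτ => ?_) hx
    have h1 : inner ℝ (∫ x in a..b, τ x) A = 0 :=
      (Submodule.mem_orthogonal _ _).1 hA _ ⟨⟨τ, hτ⟩, rfl⟩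
    rw [← h1, real_inner_comm]
    exact (innerSL ℝ A).intervalIntegral_comp_comm (hi τ hτ)

end NormalFields

/-! ### Multipliers, pendulum pairs and the conserved force. -/

section EulerLagrange

variable {n : ℕ} {a b : ℝ} {ϱ : ℝ → ℝ} {γ : ℝ → EuclideanSpace ℝ (Fin n)}

theorem IsArcLengthCurve.contDiffOn_unitTangent (hab : a < b) (hγ : IsArcLengthCurve a b γ) :
    ContDiffOn ℝ ∞ (unitTangent a b γ) (Icc a b) :=
  (contDiffOn_paramDeriv hab hγ.smooth).congr (unitTangent_eq_paramDeriv hγ.unit_speed)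

theorem IsArcLengthCurve.norm_unitTangent (hγ : IsArcLengthCurve a b γ) :
    ∀ x ∈ Icc a b, ‖unitTangent a b γ x‖ = 1 := fun x hx => by
  rw [unitTangent_eq_paramDeriv hγ.unit_speed x hx, hγ.unit_speed x hx]

/-- The conserved force of an elastic curve with multiplier `Λ`. -/
noncomputable def conservedForce (a b : ℝ) (ϱ : ℝ → ℝ) (γ : ℝ → EuclideanSpace ℝ (Fin n))
    (Λ : ℝ → ℝ) (x : ℝ) : EuclideanSpace ℝ (Fin n) :=
  ϱ x • paramDeriv a b (paramDeriv a b (unitTangent a b γ)) x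
    + paramDeriv a b ϱ x • paramDeriv a b (unitTangent a b γ) x
    + (3 / 2 * (ϱ x * inner ℝ (paramDeriv a b (unitTangent a b γ) x)
        (paramDeriv a b (unitTangent a b γ) x)) - Λ x) • unitTangent a b γ x

theorem contDiffOn_conservedForce (hab : a < b) (hϱ : IsStiffness a b ϱ)
    (hγ : IsArcLengthCurve a b γ) {Λ : ℝ → ℝ} (hΛ : ContDiffOn ℝ ∞ Λ (Icc a b)) :
    ContDiffOn ℝ ∞ (conservedForce a b ϱ γ Λ) (Icc a b) := by
  have hT := hγ.contDiffOn_unitTangent hab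
  have hT1 := contDiffOn_paramDeriv hab hT
  have hT2 := contDiffOn_paramDeriv hab hT1
  exact ((hϱ.smooth.smul hT2).add ((contDiffOn_paramDeriv hab hϱ.smooth).smul hT1)).add
    (((contDiffOn_const.mul (hϱ.smooth.mul (hT1.inner ℝ hT1))).sub hΛ).smul hT)

/-- This is the product rule: `3 ϱ ⟨T', T''⟩` comes from differentiating `3/2 ϱ ⟨T', T'⟩`, and `2 ϱ'
T''` from two equal terms. -/
theorem isMultiplier_iff (hab : a < b) (hϱ : IsStiffness a b ϱ)
    (hγ : IsArcLengthCurve a b γ) {Λ : ℝ → ℝ} (hΛ : ContDiffOn ℝ ∞ Λ (Icc a b)) :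
    IsMultiplier a b ϱ γ Λ ↔
      ∀ x ∈ Icc a b, paramDeriv a b (conservedForce a b ϱ γ Λ) x = 0 := by
  have hT := hγ.contDiffOn_unitTangent hab
  have hT1 := contDiffOn_paramDeriv hab hT
  have hT2 := contDiffOn_paramDeriv hab hT1
  have hϱ1 := contDiffOn_paramDeriv hab hϱ.smooth
  refine (and_iff_right hΛ).trans (forall₂_congr fun x hx => ?_)
  have dT := hasDerivWithinAt_paramDeriv hT hx
  have dT1 := hasDerivWithinAt_paramDeriv hT1 hx
  have dT2 := hasDerivWithinAt_paramDeriv hT2 hx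
  have dϱ := hasDerivWithinAt_paramDeriv hϱ.smooth hx
  have dϱ1 := hasDerivWithinAt_paramDeriv hϱ1 hx
  have dΛ := hasDerivWithinAt_paramDeriv hΛ hx
  have h := paramDeriv_eq hab hx (((dϱ.fun_smul dT2).fun_add (dϱ1.fun_smul dT1)).fun_add
    ((((dϱ.fun_mul (dT1.inner ℝ dT1)).const_mul (3 / 2)).fun_sub dΛ).fun_smul dT))
  have h' : paramDeriv a b (conservedForce a b ϱ γ Λ) x = _ := h
  rw [h', real_inner_comm (paramDeriv a b (unitTangent a b γ) x)
    (paramDeriv a b (paramDeriv a b (unitTangent a b γ)) x)]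
  refine Eq.congr ?_ rfl
  module

/-- The two pendulum equations are the parts of `F = A` normal and tangential to `T`; `⟨T'', T⟩ =
-|T'|²` turns the coefficient `3/2` into `1/2`. -/
theorem isPendulumPair_iff (hab : a < b)
    (hγ : IsArcLengthCurve a b γ) {Λ : ℝ → ℝ} {A : EuclideanSpace ℝ (Fin n)} :
    IsPendulumPair a b ϱ γ Λ A ↔ ∀ x ∈ Icc a b, conservedForce a b ϱ γ Λ x = A := by
  have hT := hγ.contDiffOn_unitTangent hab
  refine forall₂_and.symm.trans (forall₂_congr fun x hx => ?_)
  have hTn := hγ.norm_unitTangent x hx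
  have e1 := inner_paramDeriv_self_eq_zero hab hT hγ.norm_unitTangent hx
  have e2 := inner_paramDeriv_paramDeriv_self hab hT hγ.norm_unitTangent hx
  rw [e2, conservedForce]
  constructor
  · rintro ⟨h1, h2⟩
    refine Eq.trans ?_ (eq_sub_iff_add_eq.1 h1)
    rw [h2]
    module
  · intro h
    have h3 : inner ℝ A (unitTangent a b γ x) = 1 / 2 * ϱ x * inner ℝ
        (paramDeriv a b (unitTangent a b γ) x) (paramDeriv a b (unitTangent a b γ) x) - Λ x := by
      rw [← h, inner_add_left, inner_add_left, real_inner_smul_left, real_inner_smul_left,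
        real_inner_smul_left, e1, e2, real_inner_self_eq_norm_sq (unitTangent a b γ x), hTn]
      ring
    refine ⟨?_, by rw [h3]; ring⟩
    rw [h3, ← h]
    module

/-- An elastic curve admits a pendulum pair. -/
theorem IsElastic.exists_isPendulumPair (hab : a < b) (hϱ : IsStiffness a b ϱ)
    (hγ : IsElastic a b ϱ γ) : ∃ (Λ : ℝ → ℝ) (A : EuclideanSpace ℝ (Fin n)),
      ContDiffOn ℝ ∞ Λ (Icc a b) ∧ IsPendulumPair a b ϱ γ Λ A := by
  have hγ1 := hγ.arcLength
  have hT := contDiffOn_paramDeriv hab hγ1.smooth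
  have hT1 := contDiffOn_paramDeriv hab hT
  have hU := unitTangent_eq_paramDeriv hγ1.unit_speed
  have hU1 : ∀ x ∈ Icc a b, paramDeriv a b (unitTangent a b γ) x
      = paramDeriv a b (paramDeriv a b γ) x := fun x hx => paramDeriv_congr hx hU
  have hUs := hγ1.contDiffOn_unitTangent hab
  have hU1s := contDiffOn_paramDeriv hab hUs
  rcases paramDeriv_eq_zero_or_integral_surjective hab hT hγ1.unit_speed with h | h
  · refine ⟨fun _ => 0, 0, contDiffOn_const, (isPendulumPair_iff hab hγ1).2 fun x hx => ?_⟩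
    have h1 : ∀ y ∈ Icc a b, paramDeriv a b (unitTangent a b γ) y = 0 := fun y hy => by
      rw [hU1 y hy, h y hy]
    have h2 : paramDeriv a b (paramDeriv a b (unitTangent a b γ)) x = 0 := by
      rw [paramDeriv_congr hx h1]
      exact paramDeriv_eq hab hx (hasDerivWithinAt_const x _ 0)
    simp [conservedForce, h1 x hx, h2]
  · choose σ hσ hσi using fun i : Fin n => h (EuclideanSpace.single i 1)
    have hW := contDiffOn_bendingForce hab hϱ hγ1
    have hWeq : ∀ x ∈ Icc a b,
        paramDeriv a b (fun y => ϱ y • paramDeriv a b (paramDeriv a b γ) y) x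
        = ϱ x • paramDeriv a b (paramDeriv a b (unitTangent a b γ)) x
          + paramDeriv a b ϱ x • paramDeriv a b (unitTangent a b γ) x := by
      intro x hx
      have h1 : ∀ y ∈ Icc a b, ϱ y • paramDeriv a b (paramDeriv a b γ) y
          = ϱ y • paramDeriv a b (unitTangent a b γ) y := fun y hy => by rw [hU1 y hy]
      rw [paramDeriv_congr hx h1]
      exact paramDeriv_eq hab hx ((hasDerivWithinAt_paramDeriv hϱ.smooth hx).fun_smul
        (hasDerivWithinAt_paramDeriv hU1s hx))
    obtain ⟨W, hWd⟩ : ∃ W, W = paramDeriv a b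
      (fun y => ϱ y • paramDeriv a b (paramDeriv a b γ) y) := ⟨_, rfl⟩
    have hcrit : ∀ τ ∈ normalFields a b (paramDeriv a b γ), ∫ x in a..b, τ x = 0 →
        ∫ x in a..b, inner ℝ (W x) (τ x) = 0 := by
      rw [hWd]
      exact fun τ hτ hτi => hγ.integral_inner_force_eq_zero hab hϱ hσ hσi hτ hτi
    rw [← hWd] at hW hWeq
    have hWi : ∀ τ ∈ normalFields a b (paramDeriv a b γ),
        IntervalIntegrable (fun x => inner ℝ (W x) (τ x)) volume a b := fun τ hτ =>
      (hW.continuousOn.inner hτ.1.continuous.continuousOn).intervalIntegrable_of_Icc hab.le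
    have hi : ∀ τ ∈ normalFields a b (paramDeriv a b γ),
        IntervalIntegrable τ volume a b := fun τ hτ => hτ.1.continuous.intervalIntegrable _ _
    -- The functional `τ ↦ ∫ ⟨W, τ⟩` depends only on `∫ τ`, hence equals `⟨A, ∫ τ⟩`; its values on
    -- the `σ i` are the coordinates of `A`.
    set A : EuclideanSpace ℝ (Fin n) :=
      WithLp.toLp 2 fun i => ∫ x in a..b, inner ℝ (W x) (σ i x)
    have hWA : ∀ τ ∈ normalFields a b (paramDeriv a b γ),
        ∫ x in a..b, inner ℝ (W x - A) (τ x) = 0 := by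
      intro τ hτ
      set v := ∫ x in a..b, τ x with hv
      have hσv : ∑ i, v i • σ i ∈ normalFields a b (paramDeriv a b γ) :=
        Submodule.sum_mem _ fun i _ => Submodule.smul_mem _ _ (hσ i)
      have i2 : ∀ i ∈ Finset.univ, IntervalIntegrable (fun x => v i • σ i x) volume a b :=
        fun i _ => ((hσ i).1.continuous.const_smul (v i)).intervalIntegrable _ _
      have i3 : ∀ i ∈ Finset.univ,
          IntervalIntegrable (fun x => v i * inner ℝ (W x) (σ i x)) volume a b :=
        fun i _ => (hWi _ (hσ i)).const_mul (v i)
      have h1 : ∫ x in a..b, (∑ i, v i • σ i) x = v := by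
        simp only [Finset.sum_apply, Pi.smul_apply]
        rw [intervalIntegral.integral_finsetSum i2]
        simp only [intervalIntegral.integral_smul, hσi]
        ext j
        simp [Pi.single_apply]
      have h2 : ∫ x in a..b, inner ℝ (W x) ((∑ i, v i • σ i) x) = inner ℝ A v := by
        simp only [Finset.sum_apply, Pi.smul_apply, inner_sum, real_inner_smul_right]
        rw [intervalIntegral.integral_finsetSum i3]
        simp only [intervalIntegral.integral_const_mul]
        simp [A, PiLp.inner_apply]
      have h3 := hcrit (τ - ∑ i, v i • σ i) (Submodule.sub_mem _ hτ hσv) (by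
        simp only [Pi.sub_apply]
        rw [intervalIntegral.integral_sub (hi _ hτ) (hi _ hσv), h1, ← hv, sub_self])
      simp only [Pi.sub_apply, inner_sub_right] at h3
      rw [intervalIntegral.integral_sub (hWi _ hτ) (hWi _ hσv), h2] at h3
      simp only [inner_sub_left]
      have i4 : IntervalIntegrable (fun x => inner ℝ A (τ x)) volume a b :=
        (continuous_const.inner hτ.1.continuous).intervalIntegrable _ _
      have h4 : ∫ x in a..b, inner ℝ A (τ x) = inner ℝ A v :=
        (innerSL ℝ A).intervalIntegral_comp_comm (hi τ hτ)
      rw [intervalIntegral.integral_sub (hWi _ hτ) i4, h4, h3]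
    have key := eq_inner_smul_of_integral_eq_zero hab hT hγ1.unit_speed
      (hW.sub contDiffOn_const) hWA
    refine ⟨fun x => 1 / 2 * ϱ x * inner ℝ (paramDeriv a b (unitTangent a b γ) x)
      (paramDeriv a b (unitTangent a b γ) x) - inner ℝ A (unitTangent a b γ x), A,
      ((contDiffOn_const.mul hϱ.smooth).mul (hU1s.inner ℝ hU1s)).sub
        (contDiffOn_const.inner ℝ hUs), fun x hx => ?_, fun x _ => rfl⟩
    have h5 := key x hx
    rw [hWeq x hx, ← hU x hx, inner_sub_left, inner_add_left, real_inner_smul_left,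
      real_inner_smul_left, inner_paramDeriv_self_eq_zero hab hUs hγ1.norm_unitTangent hx,
      mul_zero, add_zero, sub_smul] at h5
    rw [sub_eq_iff_eq_add] at h5 ⊢
    rw [h5]
    abel

/-- The energy density is `Λ + ⟨A, T⟩`, and `T = γ'` integrates to `γ b - γ a`. -/
theorem IsPendulumPair.bendingEnergy_eq (hab : a < b) (hϱ : IsStiffness a b ϱ)
    (hγ : IsArcLengthCurve a b γ) {Λ : ℝ → ℝ} {A : EuclideanSpace ℝ (Fin n)}
    (h : IsPendulumPair a b ϱ γ Λ A) :
    bendingEnergy a b ϱ γ = (∫ x in a..b, Λ x) + inner ℝ A (γ b - γ a) := by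
  have hT := contDiffOn_paramDeriv hab hγ.smooth
  have hT1 := contDiffOn_paramDeriv hab hT
  have hU := unitTangent_eq_paramDeriv hγ.unit_speed
  have h1 : ∀ x ∈ Icc a b, Λ x = 1 / 2 * (ϱ x * ‖paramDeriv a b (paramDeriv a b γ) x‖ ^ 2)
      - inner ℝ A (paramDeriv a b γ x) := by
    intro x hx
    rw [h.2 x hx, hU x hx, paramDeriv_congr hx hU, real_inner_self_eq_norm_sq]
    ring
  have i1 : IntervalIntegrable
      (fun x => 1 / 2 * (ϱ x * ‖paramDeriv a b (paramDeriv a b γ) x‖ ^ 2)) volume a b :=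
    ((continuousOn_const.mul (hϱ.smooth.continuousOn.mul
      (hT1.continuousOn.norm.pow 2)))).intervalIntegrable_of_Icc hab.le
  have i2 : IntervalIntegrable (fun x => inner ℝ A (paramDeriv a b γ x)) volume a b :=
    (continuousOn_const.inner hT.continuousOn).intervalIntegrable_of_Icc hab.le
  have h2 : ∫ x in a..b, inner ℝ A (paramDeriv a b γ x) = inner ℝ A (γ b - γ a) := by
    rw [← integral_paramDeriv hab hγ.smooth]
    exact (innerSL ℝ A).intervalIntegral_comp_comm
      (hT.continuousOn.intervalIntegrable_of_Icc hab.le)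
  rw [ElasticCurve.bendingEnergy_eq hab hγ.unit_speed, integral_congr_Icc hab h1,
    intervalIntegral.integral_sub i1 i2, h2, sub_add_cancel]

end EulerLagrange

end ElasticCurve

theorem corollary5p3 (n : ℕ) (hn : 2 ≤ n) (a b : ℝ) (hab : a < b)
    (ϱ : ℝ → ℝ) (hϱ : ElasticCurve.IsStiffness a b ϱ)
    (γ : ℝ → EuclideanSpace ℝ (Fin n)) (hγ : ElasticCurve.IsElastic a b ϱ γ) :
    (∃ Λ : ℝ → ℝ, ElasticCurve.IsMultiplier a b ϱ γ Λ) ∧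
    (∀ Λ : ℝ → ℝ, ElasticCurve.IsMultiplier a b ϱ γ Λ →
      ∃ A : EuclideanSpace ℝ (Fin n), ElasticCurve.IsPendulumPair a b ϱ γ Λ A) ∧
    (∀ (Λ : ℝ → ℝ) (A : EuclideanSpace ℝ (Fin n)), ElasticCurve.IsPendulumPair a b ϱ γ Λ A →
      ElasticCurve.bendingEnergy a b ϱ γ = (∫ x in a..b, Λ x) + inner ℝ A (γ b - γ a)) := by
  have hγ1 := hγ.arcLength
  refine ⟨?_, fun Λ hΛ => ?_, fun Λ A h => h.bendingEnergy_eq hab hϱ hγ1⟩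
  · obtain ⟨Λ, A, hΛ, hA⟩ := hγ.exists_isPendulumPair hab hϱ
    refine ⟨Λ, (ElasticCurve.isMultiplier_iff hab hϱ hγ1 hΛ).2 fun x hx => ?_⟩
    rw [ElasticCurve.paramDeriv_congr hx ((ElasticCurve.isPendulumPair_iff hab hγ1).1 hA)]
    exact ElasticCurve.paramDeriv_eq hab hx (hasDerivWithinAt_const x _ A)
  -- The conserved force is constant, so its value at `a` serves as `A`.
  · refine ⟨ElasticCurve.conservedForce a b ϱ γ Λ a,
      (ElasticCurve.isPendulumPair_iff hab hγ1).2 ?_⟩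
    exact constant_of_derivWithin_zero
      ((ElasticCurve.contDiffOn_conservedForce hab hϱ hγ1 hΛ.1).differentiableOn (by simp))
      fun x hx => (ElasticCurve.isMultiplier_iff hab hϱ hγ1 hΛ.1).1 hΛ x (Set.Ico_subset_Icc_self hx)
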